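/- Let $H^A=\mathbb C^{d_A}$ and $H^B=\mathbb C^{d_B}$, and suppose that $\{\Pi_t\}_{t=1}^{d_A+1}$, $\Pi_t=\{|b_{ti}\rangle : i=1,\dots,d_A\}$, is a complete set of mutually unbiased bases of $H^A$, that is, $d_A+1$ orthonormal bases with $|\langle b_{sj}|b_{tk}\rangle|=1/\sqrt{d_A}$ for all $s\ne t$ and all $j,k$. (Such sets exist when $d_A$ is a prime power.) For a density operator $\rho$ and a Hermitian operator $O$, let $I(\rho,O)=-\frac12\operatorname{tr}\big([\sqrt\rho,O]^2\big)$ be the Wigner–Yanase skew information. For a density operator $\rho^{AB}$ on $H^A\otimes H^B$ with reduced states $\rho^A=\operatorname{tr}_B\rho^{AB}$ and $\rho^B=\operatorname{tr}_A\rho^{AB}$, and an orthonormal basis $\Pi=\{|i\rangle\}$ of $H^A$, put $$C(\rho^{AB}|\Pi\otimes\mathbb I_B)=\sum_{i=1}^{d_A} I\big(\rho^{AB},|i\rangle\langle i|\otimes \mathbf 1^B\big),\qquad Q(\rho^{AB}|\Pi)=C(\rho^{AB}|\Pi\otimes\mathbb I_B)-C(\rho^A\otimes\rho^B|\Pi\otimes\mathbb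 I_B),$$ $$Q_{mub}(\rho^{AB})=\frac1{d_A+1}\sum_{t=1}^{d_A+1}Q(\rho^{AB}|\Pi_t).$$ Then, for every density operator $\rho^{AB}$ on $H^A\otimes H^B$: (a) (Non-negativity) $Q_{mub}(\rho^{AB})\ge 0$, and equality holds if $\rho^{AB}=\rho^A\otimes\rho^B$ is a product state. (b) (Contractivity) For every quantum channel (completely positive trace-preserving linear map) $\Phi$ from operators on $H^B$ to operators on a space $\mathbb C^{d_B'}$ (for instance $d_B'=d_B$), $$Q_{mub}\big((\mathcal I_A\otimes\Phi)(\rho^{AB})\big)\le Q_{mub}(\rho^{AB}),$$ where $\mathcal I_A$ is the identity channel on $A$ and both sides use the same bases $\Pi_t$. (c) (Local unitary invariance) For all unitary operators $U_A$ on $H^A$ and $U_B$ on $H^B$, $$Q_{mub}\big((U_A\otimes U_B)\,\rho^{AB}\,(U_A\otimes U_B)^\dagger\big)=Q_{mub}(\rho^{AB}),$$ and $$Q_{mub}(\rho^{AB})=\frac{\big(\operatorname{tr}\sqrt{\rho^A}\big)^2-\operatorname{tr}_B\Big[\big(\operatorname{tr}_A\sqrt{\rho^{AB}}\big)^2\Big]}{d_A+1}.$$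 -/

import Mathlib

open Matrix
open scoped Kronecker MatrixOrder ComplexOrder

namespace AvgCorrelation

/-- A quantum state (density operator): a positive semidefinite matrix of trace one. -/
def IsState {n : Type*} [Fintype n] (ρ : Matrix n n ℂ) : Prop :=
  ρ.PosSemidef ∧ ρ.trace = 1

/-- Partial trace over the second tensor factor. -/
def traceB {a b : Type*} [Fintype b] (M : Matrix (a × b) (a × b) ℂ) : Matrix a a ℂ :=
  Matrix.of fun i j => ∑ k, M (i, k) (j, k)

/-- Partial trace over the first tensor factor. -/
def traceA {a b : Type*} [Fintype a] (M : Matrix (a × b) (a × b) ℂ) : Matrix b b ℂ :=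
  Matrix.of fun k l => ∑ i, M (i, k) (i, l)

/-- The Wigner-Yanase skew information `I(ρ, O) = -(1/2) tr [√ρ, O]²`, with `√ρ` the positive
semidefinite square root.  The trace is real for Hermitian `O`, see `coe_skewInfo`. -/
noncomputable def skewInfo {n : Type*} [Fintype n] [DecidableEq n] (ρ O : Matrix n n ℂ) : ℝ :=
  (-(1 / 2 : ℂ) * ((CFC.sqrt ρ * O - O * CFC.sqrt ρ) ^ 2).trace).re

/-- An orthonormal basis of `ℂ^d`, indexed by `Fin d`. -/
abbrev ONB (d : ℕ) : Type := OrthonormalBasis (Fin d) ℂ (EuclideanSpace ℂ (Fin d))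

/-- The rank-one projection `|v⟩⟨v|`. -/
def ketbra {d : ℕ} (v : EuclideanSpace ℂ (Fin d)) : Matrix (Fin d) (Fin d) ℂ :=
  Matrix.of fun i j => v i * star (v j)

/-- The coherence `C(ρ | P) = ∑ᵢ I(ρ, |i⟩⟨i|)`. -/
noncomputable def coherence {d : ℕ} (ρ : Matrix (Fin d) (Fin d) ℂ) (P : ONB d) : ℝ :=
  ∑ i, skewInfo ρ (ketbra (P i))

/-- The partial coherence `C(ρ | P ⊗ 𝕀_B) = ∑ᵢ I(ρ, |i⟩⟨i| ⊗ 1)`. -/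
noncomputable def partialCoherence {dA dB : ℕ}
    (ρ : Matrix (Fin dA × Fin dB) (Fin dA × Fin dB) ℂ) (P : ONB dA) : ℝ :=
  ∑ i, skewInfo ρ (ketbra (P i) ⊗ₖ (1 : Matrix (Fin dB) (Fin dB) ℂ))

/-- The correlation `Q(ρ | P) = C(ρ | P ⊗ 𝕀_B) - C(ρ^A ⊗ ρ^B | P ⊗ 𝕀_B)`.
For states the second term is `C(ρ^A | P)`, see `correlation_eq`. -/
noncomputable def correlation {dA dB : ℕ}
    (ρ : Matrix (Fin dA × Fin dB) (Fin dA × Fin dB) ℂ) (P : ONB dA) : ℝ :=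
  partialCoherence ρ P - partialCoherence (traceB ρ ⊗ₖ traceA ρ) P

/-- Two orthonormal bases of `ℂ^d` are mutually unbiased. -/
def MutuallyUnbiased {d : ℕ} (P₁ P₂ : ONB d) : Prop :=
  ∀ j k, ‖inner ℂ (P₁ j) (P₂ k)‖ = 1 / √(d : ℝ)

/-- A complete set of mutually unbiased bases of `ℂ^d`: `d + 1` orthonormal bases, any two of
which are mutually unbiased. -/
def IsCompleteMUB {d : ℕ} (B : Fin (d + 1) → ONB d) : Prop :=
  ∀ s t, s ≠ t → MutuallyUnbiased (B s) (B t)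

/-- The average correlation `(1/(d_A+1)) ∑ₜ Q(ρ | Pₜ)` over `d_A + 1` bases of the first factor. -/
noncomputable def Qmub {dA dB : ℕ} (B : Fin (dA + 1) → ONB dA)
    (ρ : Matrix (Fin dA × Fin dB) (Fin dA × Fin dB) ℂ) : ℝ :=
  1 / ((dA : ℝ) + 1) * ∑ t, correlation ρ (B t)

/-- The map `id ⊗ Φ`: apply `Φ` to each block `(M (i, ·) (j, ·))`. -/
def idTensor {a b c : Type*} (Φ : Matrix b b ℂ →ₗ[ℂ] Matrix c c ℂ)
    (M : Matrix (a × b) (a × b) ℂ) : Matrix (a × c) (a × c) ℂ :=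
  Matrix.of fun p q => Φ (Matrix.of fun k l => M (p.1, k) (q.1, l)) p.2 q.2

/-- A quantum channel: a completely positive trace-preserving linear map. -/
def IsChannel {b c : Type*} [Fintype b] [Fintype c]
    (Φ : Matrix b b ℂ →ₗ[ℂ] Matrix c c ℂ) : Prop :=
  (∀ (n : ℕ) (M : Matrix (Fin n × b) (Fin n × b) ℂ),
    M.PosSemidef → (idTensor Φ M).PosSemidef) ∧
  ∀ X, (Φ X).trace = X.trace

theorem idTensor_kronecker {a b c : Type*} (Φ : Matrix b b ℂ →ₗ[ℂ] Matrix c c ℂ)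
    (X : Matrix a a ℂ) (Y : Matrix b b ℂ) : idTensor Φ (X ⊗ₖ Y) = X ⊗ₖ Φ Y := by
  ext ⟨i, k⟩ ⟨j, l⟩
  have h : (Matrix.of fun k l => X i j * Y k l) = X i j • Y := by
    ext; simp
  simp [idTensor, Matrix.kroneckerMap_apply, h]

theorem ketbra_isHermitian {d : ℕ} (v : EuclideanSpace ℂ (Fin d)) : (ketbra v).IsHermitian := by
  ext i j
  simp [ketbra, mul_comm]

theorem coe_skewInfo {n : Type*} [Fintype n] [DecidableEq n] (ρ O : Matrix n n ℂ)
    (hO : O.IsHermitian) :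
    (skewInfo ρ O : ℂ) =
      -(1 / 2 : ℂ) * ((CFC.sqrt ρ * O - O * CFC.sqrt ρ) ^ 2).trace := by
  have hs : (CFC.sqrt ρ)ᴴ = CFC.sqrt ρ := (CFC.sqrt_nonneg ρ).posSemidef.1
  have hC : (CFC.sqrt ρ * O - O * CFC.sqrt ρ)ᴴ = -(CFC.sqrt ρ * O - O * CFC.sqrt ρ) := by
    rw [conjTranspose_sub, conjTranspose_mul, conjTranspose_mul, hs, hO.eq, neg_sub]
  have ht : star ((CFC.sqrt ρ * O - O * CFC.sqrt ρ) ^ 2).trace =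
      ((CFC.sqrt ρ * O - O * CFC.sqrt ρ) ^ 2).trace := by
    rw [← trace_conjTranspose, conjTranspose_pow, hC, neg_sq]
  refine Complex.conj_eq_iff_re.mp ?_
  rw [map_mul, starRingEnd_apply, starRingEnd_apply, ht]
  simp

theorem sqrt_kronecker {m n : Type*} [Fintype m] [DecidableEq m] [Fintype n] [DecidableEq n]
    {σ : Matrix m m ℂ} {τ : Matrix n n ℂ} (hσ : σ.PosSemidef) (hτ : τ.PosSemidef) :
    CFC.sqrt (σ ⊗ₖ τ) = CFC.sqrt σ ⊗ₖ CFC.sqrt τ := by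
  rw [CFC.sqrt_eq_iff _ _ (hσ.kronecker hτ).nonneg
    ((CFC.sqrt_nonneg σ).posSemidef.kronecker (CFC.sqrt_nonneg τ).posSemidef).nonneg,
    ← mul_kronecker_mul, CFC.sqrt_mul_sqrt_self σ hσ.nonneg, CFC.sqrt_mul_sqrt_self τ hτ.nonneg]

theorem skewInfo_kronecker {m n : Type*} [Fintype m] [DecidableEq m] [Fintype n] [DecidableEq n]
    {σ : Matrix m m ℂ} {τ : Matrix n n ℂ} (hσ : IsState σ) (hτ : IsState τ) (O : Matrix m m ℂ) :
    skewInfo (σ ⊗ₖ τ) (O ⊗ₖ (1 : Matrix n n ℂ)) = skewInfo σ O := by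
  have h : CFC.sqrt σ ⊗ₖ CFC.sqrt τ * O ⊗ₖ (1 : Matrix n n ℂ)
      - O ⊗ₖ (1 : Matrix n n ℂ) * CFC.sqrt σ ⊗ₖ CFC.sqrt τ
      = (CFC.sqrt σ * O - O * CFC.sqrt σ) ⊗ₖ CFC.sqrt τ := by
    rw [← mul_kronecker_mul, ← mul_kronecker_mul, mul_one, one_mul]
    ext ⟨i, k⟩ ⟨j, l⟩
    simp [kroneckerMap_apply, sub_mul]
  unfold skewInfo
  rw [sqrt_kronecker hσ.1 hτ.1, h, pow_two, ← mul_kronecker_mul, trace_kronecker,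
    CFC.sqrt_mul_sqrt_self τ hτ.1.nonneg, hτ.2, mul_one, ← pow_two]

theorem IsState.traceB {a b : Type*} [Fintype a] [Fintype b]
    {ρ : Matrix (a × b) (a × b) ℂ} (hρ : IsState ρ) : IsState (traceB ρ) := by
  refine ⟨?_, ?_⟩
  · have h : AvgCorrelation.traceB ρ
        = ∑ k, ρ.submatrix (fun i : a => (i, k)) (fun i : a => (i, k)) := by
      ext i j
      simp [AvgCorrelation.traceB, Matrix.sum_apply]
    rw [h]
    exact posSemidef_sum _ fun k _ => hρ.1.submatrix _
  · rw [← hρ.2]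
    simp [Matrix.trace, AvgCorrelation.traceB, Fintype.sum_prod_type]

theorem IsState.traceA {a b : Type*} [Fintype a] [Fintype b]
    {ρ : Matrix (a × b) (a × b) ℂ} (hρ : IsState ρ) : IsState (traceA ρ) := by
  refine ⟨?_, ?_⟩
  · have h : AvgCorrelation.traceA ρ
        = ∑ i, ρ.submatrix (fun k : b => (i, k)) (fun k : b => (i, k)) := by
      ext i j
      simp [AvgCorrelation.traceA, Matrix.sum_apply]
    rw [h]
    exact posSemidef_sum _ fun k _ => hρ.1.submatrix _
  · rw [← hρ.2]
    simp [Matrix.trace, AvgCorrelation.traceA, Fintype.sum_prod_type_right]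

/-- For states, `Q(ρ | P) = C(ρ | P ⊗ 𝕀_B) - C(ρ^A | P)`. -/
theorem correlation_eq {dA dB : ℕ} {ρ : Matrix (Fin dA × Fin dB) (Fin dA × Fin dB) ℂ}
    (hρ : IsState ρ) (P : ONB dA) :
    correlation ρ P = partialCoherence ρ P - coherence (traceB ρ) P := by
  simp only [correlation, coherence]
  congr 1
  exact Finset.sum_congr rfl fun i _ => skewInfo_kronecker hρ.traceB hρ.traceA _

end AvgCorrelation

open AvgCorrelation

/-
For a projection `K` one has `I(ρ, K) = tr(ρ K) - tr(√ρ K √ρ K)`, so `Q(ρ | Π)` is a sum over the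
projections `K` of `Π` of the differences `tr(√ρᴬ K √ρᴬ K) - tr(√ρ (K ⊗ 1) √ρ (K ⊗ 1))`.

Non-negativity and contractivity are two instances of one monotonicity statement for the quadratic
form `X ↦ tr(X† √R₁ X √R₂)`. Vectorizing `X` turns this form into the Kronecker product `√R₂ᵀ ⊗ √R₁`
of two commuting square roots, and a positive 2 × 2 block matrix with commuting diagonal blocks
`p²`, `q²` and Hermitian off-diagonal blocks `T` satisfies `T ≤ pq`; so it suffices to compare the
forms `tr(X† R₁ X)` and `tr(X† X R₂)`. For the partial trace both comparisons are equalities, for a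
channel they are the Kadison–Schwarz inequality of its dual.

A complete set of mutually unbiased bases is a projective 2-design, `∑ K ⊗ K = 1 + swap`. This
evaluates the sum over all bases, and the resulting closed form is invariant under local unitaries.
-/

namespace AvgCorrelation

theorem le_of_mul_self_le_mul_self {A : Type*} [CStarAlgebra A] [PartialOrder A] [StarOrderedRing A]
    {a b : A} (ha : IsSelfAdjoint a) (hb : 0 ≤ b) (hab : a * a ≤ b * b) : a ≤ b := by
  have habs : CFC.abs a ≤ b := by
    simpa only [CFC.abs, ha.star_eq, CFC.sqrt_mul_self b hb] using CFC.sqrt_le_sqrt _ _ hab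
  refine le_trans (sub_nonneg.1 ?_) habs
  rw [CFC.abs_sub_self a ha]
  exact nsmul_nonneg (CFC.negPart_nonneg a) 2

section BlockMatrix

theorem posSemidef_fromBlocks_zero_zero {m n : Type*} [Finite m] [Finite n]
    {A : Matrix m m ℂ} {D : Matrix n n ℂ} (hA : A.PosSemidef) (hD : D.PosSemidef) :
    (fromBlocks A 0 0 D).PosSemidef := by
  classical
  cases nonempty_fintype m
  cases nonempty_fintype n
  obtain ⟨a, rfl⟩ := CStarAlgebra.nonneg_iff_eq_star_mul_self.1 hA.nonneg
  obtain ⟨d, rfl⟩ := CStarAlgebra.nonneg_iff_eq_star_mul_self.1 hD.nonneg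
  simpa [fromBlocks_conjTranspose, fromBlocks_multiply, star_eq_conjTranspose] using
    posSemidef_conjTranspose_mul_self (fromBlocks a 0 0 d)

open scoped Matrix.Norms.L2Operator

variable {n : Type*} [Fintype n] {p q T : Matrix n n ℂ}

theorem le_mul_of_posSemidef_fromBlocks_of_posDef (hp : p.PosSemidef) (hq : q.PosDef)
    (hpq : Commute p q) (hT : T.IsHermitian)
    (h : (fromBlocks (p * p) T T (q * q)).PosSemidef) : T ≤ p * q := by
  classical
  have hdet : IsUnit q.det := (isUnit_iff_isUnit_det q).1 hq.isUnit
  have hr : IsSelfAdjoint q⁻¹ := hq.inv.isHermitian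
  have hcomm : Commute p q⁻¹ := by
    obtain ⟨u, rfl⟩ := hq.isUnit
    simpa only [coe_units_inv] using hpq.units_inv_right
  have hschur : T * (q⁻¹ * q⁻¹) * T ≤ p * p := by
    have hqq : (q * q).PosDef := by
      simpa only [hq.isHermitian.eq] using
        PosDef.conjTranspose_mul_self q (mulVec_injective_of_isUnit hq.isUnit)
    have := hqq.isUnit.invertible
    rw [← Matrix.mul_inv_rev, Matrix.le_iff]
    nth_rw 2 [← hT.eq]
    exact (PosDef.fromBlocks₂₂ _ _ hqq).1 (by rwa [hT.eq])
  have hsq : q⁻¹ * T * q⁻¹ * (q⁻¹ * T * q⁻¹) ≤ p * q⁻¹ * (p * q⁻¹) := by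
    calc q⁻¹ * T * q⁻¹ * (q⁻¹ * T * q⁻¹) = q⁻¹ * (T * (q⁻¹ * q⁻¹) * T) * q⁻¹ := by
          simp only [mul_assoc]
      _ ≤ q⁻¹ * (p * p) * q⁻¹ := hr.conjugate_le_conjugate hschur
      _ = p * q⁻¹ * (p * q⁻¹) := by
          rw [← mul_assoc q⁻¹, ← hcomm.eq, mul_assoc]
  have hle : q⁻¹ * T * q⁻¹ ≤ p * q⁻¹ :=
    le_of_mul_self_le_mul_self (hT.isSelfAdjoint.conjugate_self hr)
      (hcomm.mul_nonneg hp.nonneg hq.inv.posSemidef.nonneg) hsq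
  calc T = q * (q⁻¹ * T * q⁻¹) * q := by
        simp only [mul_assoc, nonsing_inv_mul q hdet, mul_nonsing_inv_cancel_left q _ hdet, mul_one]
    _ ≤ q * (p * q⁻¹) * q := hq.isHermitian.isSelfAdjoint.conjugate_le_conjugate hle
    _ = p * q := by
        rw [mul_assoc, mul_assoc p, nonsing_inv_mul q hdet, mul_one, hpq.eq]

theorem le_mul_of_posSemidef_fromBlocks (hp : p.PosSemidef) (hq : q.PosSemidef)
    (hpq : Commute p q) (hT : T.IsHermitian)
    (h : (fromBlocks (p * p) T T (q * q)).PosSemidef) : T ≤ p * q := by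
  classical
  have hshift : ∀ ε : ℝ, 0 < ε → T ≤ p * (q + (ε : ℂ) • 1) := by
    intro ε hε
    have hε' : (0 : ℂ) < ε := Complex.zero_lt_real.2 hε
    have hqε : (q + (ε : ℂ) • 1).PosDef := PosDef.posSemidef_add hq (PosDef.one.smul hε')
    refine le_mul_of_posSemidef_fromBlocks_of_posDef hp hqε
      (hpq.add_right ((Commute.one_right p).smul_right _)) hT ?_
    have hextra : ((2 * ε : ℂ) • q + (ε * ε : ℂ) • 1).PosSemidef :=
      (hq.smul (by positivity)).add (PosSemidef.one.smul (by positivity))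
    have hblock : fromBlocks (p * p) T T ((q + (ε : ℂ) • 1) * (q + (ε : ℂ) • 1)) =
        fromBlocks (p * p) T T (q * q) +
          fromBlocks 0 0 0 ((2 * ε : ℂ) • q + (ε * ε : ℂ) • 1) := by
      simp only [fromBlocks_add, add_zero]
      congr 1
      simp only [add_mul, mul_add, smul_mul_assoc, mul_smul_comm, one_mul, mul_one]
      module
    rw [hblock]
    exact h.add (posSemidef_fromBlocks_zero_zero PosSemidef.zero hextra)
  have hlim : Filter.Tendsto (fun ε : ℝ => p * (q + (ε : ℂ) • 1)) (nhdsWithin 0 (Set.Ioi 0))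
      (nhds (p * q)) := by
    have hcont : Continuous fun ε : ℝ => p * (q + (ε : ℂ) • 1) := by fun_prop
    simpa using (hcont.tendsto 0).mono_left nhdsWithin_le_nhds
  exact ge_of_tendsto hlim (Filter.eventually_of_mem self_mem_nhdsWithin hshift)

theorem conjTranspose_mul_mul_le_mul {m : Type*} [Fintype m] {a b : Matrix m m ℂ}
    (ha : a.IsHermitian) (hb : b.IsHermitian) (hab : Commute a b)
    (hp : p.PosSemidef) (hq : q.PosSemidef) (hpq : Commute p q) (L : Matrix m n ℂ)
    (hap : Lᴴ * (a * a) * L ≤ p * p) (hbq : Lᴴ * (b * b) * L ≤ q * q) :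
    Lᴴ * (a * b) * L ≤ p * q := by
  have hT : (Lᴴ * (a * b) * L).IsHermitian :=
    isHermitian_conjTranspose_mul_mul L ((IsHermitian.commute_iff ha hb).1 hab)
  refine le_mul_of_posSemidef_fromBlocks hp hq hpq hT ?_
  have hblock : fromBlocks (p * p) (Lᴴ * (a * b) * L) (Lᴴ * (a * b) * L) (q * q) =
      (fromCols (a * L) (b * L))ᴴ * fromCols (a * L) (b * L) +
        fromBlocks (p * p - Lᴴ * (a * a) * L) 0 0 (q * q - Lᴴ * (b * b) * L) := by
    rw [conjTranspose_fromCols_eq_fromRows_conjTranspose, fromRows_mul_fromCols, fromBlocks_add]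
    simp only [conjTranspose_mul, ha.eq, hb.eq, Matrix.mul_assoc, add_zero, add_sub_cancel]
    rw [← Matrix.mul_assoc b, ← hab.eq, Matrix.mul_assoc]
  rw [hblock]
  exact (posSemidef_conjTranspose_mul_self _).add
    (posSemidef_fromBlocks_zero_zero (Matrix.le_iff.1 hap) (Matrix.le_iff.1 hbq))

end BlockMatrix

section Vectorization

variable {m m' n n' : Type*} [Fintype n] [Fintype n']

theorem isHermitian_kronecker {m n : Type*} {A : Matrix m m ℂ} {B : Matrix n n ℂ}
    (hA : A.IsHermitian) (hB : B.IsHermitian) : (A ⊗ₖ B).IsHermitian := by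
  rw [IsHermitian, conjTranspose_kronecker, hA.eq, hB.eq]

theorem exists_mulVec_vec_eq (Ψ : Matrix n n' ℂ →ₗ[ℂ] Matrix m m' ℂ) :
    ∃ L : Matrix (m' × m) (n' × n) ℂ, ∀ X, L *ᵥ vec X = vec (Ψ X) := by
  classical
  let ℓ : (n' × n → ℂ) →ₗ[ℂ] (m' × m → ℂ) :=
    { toFun := fun x => vec (Ψ (of fun i j => x (j, i)))
      map_add' := fun x y => by rw [← vec_add, ← map_add]; rfl
      map_smul' := fun c x => by rw [RingHom.id_apply, ← vec_smul, ← map_smul]; rfl }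
  exact ⟨LinearMap.toMatrix' ℓ, fun X => LinearMap.toMatrix'_mulVec ℓ (vec X)⟩

variable [Fintype m] [Fintype m']

theorem star_vec_dotProduct_kronecker_mulVec_vec (A : Matrix m m ℂ) (B : Matrix m' m' ℂ)
    (X : Matrix m m' ℂ) :
    star (vec X) ⬝ᵥ (Bᵀ ⊗ₖ A) *ᵥ vec X = (Xᴴ * A * X * B).trace := by
  rw [kronecker_mulVec_vec, star_vec_dotProduct_vec, transpose_transpose]
  simp only [Matrix.mul_assoc]

theorem conjTranspose_mul_kronecker_mul_le_iff {Ψ : Matrix n n' ℂ →ₗ[ℂ] Matrix m m' ℂ}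
    {L : Matrix (m' × m) (n' × n) ℂ} (hL : ∀ X, L *ᵥ vec X = vec (Ψ X))
    {A : Matrix m m ℂ} {B : Matrix m' m' ℂ} {C : Matrix n n ℂ} {D : Matrix n' n' ℂ}
    (hA : A.IsHermitian) (hB : B.IsHermitian) (hC : C.IsHermitian) (hD : D.IsHermitian) :
    Lᴴ * (Bᵀ ⊗ₖ A) * L ≤ Dᵀ ⊗ₖ C ↔
      ∀ X, ((Ψ X)ᴴ * A * Ψ X * B).trace ≤ (Xᴴ * C * X * D).trace := by
  have hform : ∀ X, star (vec X) ⬝ᵥ (Dᵀ ⊗ₖ C - Lᴴ * (Bᵀ ⊗ₖ A) * L) *ᵥ vec X =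
      (Xᴴ * C * X * D).trace - ((Ψ X)ᴴ * A * Ψ X * B).trace := fun X => by
    rw [sub_mulVec, dotProduct_sub, star_vec_dotProduct_kronecker_mulVec_vec,
      ← star_vec_dotProduct_kronecker_mulVec_vec A B (Ψ X), ← hL X, star_mulVec,
      ← mulVec_mulVec, ← mulVec_mulVec, dotProduct_mulVec _ Lᴴ]
  have hherm : (Dᵀ ⊗ₖ C - Lᴴ * (Bᵀ ⊗ₖ A) * L).IsHermitian :=
    (isHermitian_kronecker hD.transpose hC).sub
      (isHermitian_conjTranspose_mul_mul L (isHermitian_kronecker hB.transpose hA))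
  rw [Matrix.le_iff, posSemidef_iff_dotProduct_mulVec, and_iff_right hherm,
    vec_bijective.surjective.forall]
  simp only [hform, sub_nonneg]

end Vectorization

section WignerYanase

variable {m m' n n' : Type*} [Fintype m] [DecidableEq m] [Fintype m'] [DecidableEq m']
  [Fintype n] [DecidableEq n] [Fintype n'] [DecidableEq n']

theorem posSemidef_sqrt (M : Matrix m m ℂ) : (CFC.sqrt M).PosSemidef :=
  (CFC.sqrt_nonneg M).posSemidef

theorem sqrt_transpose {M : Matrix m m ℂ} (hM : M.PosSemidef) :
    CFC.sqrt Mᵀ = (CFC.sqrt M)ᵀ :=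
  CFC.sqrt_unique (by rw [← transpose_mul, CFC.sqrt_mul_sqrt_self M hM.nonneg])
    (posSemidef_sqrt M).transpose.nonneg

theorem commute_one_kronecker_kronecker_one (A : Matrix m m ℂ) (B : Matrix n n ℂ) :
    Commute ((1 : Matrix n n ℂ) ⊗ₖ A) (B ⊗ₖ 1) := by
  simp only [Commute, SemiconjBy, ← mul_kronecker_mul, one_mul, mul_one]

theorem conjTranspose_mul_sqrt_kronecker_sqrt_mul_le
    {A : Matrix m m ℂ} {B : Matrix m' m' ℂ} {C : Matrix n n ℂ} {D : Matrix n' n' ℂ}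
    (hA : A.PosSemidef) (hB : B.PosSemidef) (hC : C.PosSemidef) (hD : D.PosSemidef)
    {L : Matrix (m' × m) (n' × n) ℂ}
    (hL₁ : Lᴴ * ((1 : Matrix m' m' ℂ) ⊗ₖ A) * L ≤ (1 : Matrix n' n' ℂ) ⊗ₖ C)
    (hL₂ : Lᴴ * (B ⊗ₖ (1 : Matrix m m ℂ)) * L ≤ D ⊗ₖ (1 : Matrix n n ℂ)) :
    Lᴴ * (CFC.sqrt B ⊗ₖ CFC.sqrt A) * L ≤ CFC.sqrt D ⊗ₖ CFC.sqrt C := by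
  have h := conjTranspose_mul_mul_le_mul (a := 1 ⊗ₖ CFC.sqrt A) (b := CFC.sqrt B ⊗ₖ 1)
    (p := 1 ⊗ₖ CFC.sqrt C) (q := CFC.sqrt D ⊗ₖ 1)
    (isHermitian_kronecker isHermitian_one (posSemidef_sqrt A).1)
    (isHermitian_kronecker (posSemidef_sqrt B).1 isHermitian_one)
    (commute_one_kronecker_kronecker_one _ _)
    (PosSemidef.one.kronecker (posSemidef_sqrt C)) ((posSemidef_sqrt D).kronecker PosSemidef.one)
    (commute_one_kronecker_kronecker_one _ _) L
  simpa only [← mul_kronecker_mul, one_mul, mul_one, CFC.sqrt_mul_sqrt_self _ hA.nonneg,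
    CFC.sqrt_mul_sqrt_self _ hB.nonneg, CFC.sqrt_mul_sqrt_self _ hC.nonneg,
    CFC.sqrt_mul_sqrt_self _ hD.nonneg, hL₁, hL₂, true_imp_iff] using h

theorem trace_conjTranspose_mul_sqrt_mul_mul_sqrt_le (Ψ : Matrix n n' ℂ →ₗ[ℂ] Matrix m m' ℂ)
    {R₁ : Matrix m m ℂ} {R₂ : Matrix m' m' ℂ} {σ₁ : Matrix n n ℂ} {σ₂ : Matrix n' n' ℂ}
    (hR₁ : R₁.PosSemidef) (hR₂ : R₂.PosSemidef) (hσ₁ : σ₁.PosSemidef) (hσ₂ : σ₂.PosSemidef)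
    (h₁ : ∀ X, ((Ψ X)ᴴ * R₁ * Ψ X).trace ≤ (Xᴴ * σ₁ * X).trace)
    (h₂ : ∀ X, ((Ψ X)ᴴ * Ψ X * R₂).trace ≤ (Xᴴ * X * σ₂).trace) (X : Matrix n n' ℂ) :
    ((Ψ X)ᴴ * CFC.sqrt R₁ * Ψ X * CFC.sqrt R₂).trace ≤
      (Xᴴ * CFC.sqrt σ₁ * X * CFC.sqrt σ₂).trace := by
  obtain ⟨L, hL⟩ := exists_mulVec_vec_eq Ψ
  refine (conjTranspose_mul_kronecker_mul_le_iff hL (posSemidef_sqrt R₁).1 (posSemidef_sqrt R₂).1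
    (posSemidef_sqrt σ₁).1 (posSemidef_sqrt σ₂).1).1 ?_ X
  rw [← sqrt_transpose hR₂, ← sqrt_transpose hσ₂]
  refine conjTranspose_mul_sqrt_kronecker_sqrt_mul_le hR₁ hR₂.transpose hσ₁ hσ₂.transpose ?_ ?_
  · simpa only [transpose_one] using
      (conjTranspose_mul_kronecker_mul_le_iff hL hR₁.1 isHermitian_one hσ₁.1 isHermitian_one).2
        (by simpa only [Matrix.mul_one] using h₁)
  · exact (conjTranspose_mul_kronecker_mul_le_iff hL isHermitian_one hR₂.1 isHermitian_one hσ₂.1).2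
      (by simpa only [Matrix.mul_one] using h₂)

end WignerYanase

section PartialTrace

theorem posSemidef_traceB {a b : Type*} [Fintype b] {M : Matrix (a × b) (a × b) ℂ}
    (hM : M.PosSemidef) : (traceB M).PosSemidef := by
  have hblocks : traceB M = ∑ k, M.submatrix (fun i => (i, k)) fun i => (i, k) := by
    ext i j
    simp only [traceB, of_apply, Matrix.sum_apply, submatrix_apply]
  rw [hblocks]
  exact posSemidef_sum _ fun k _ => hM.submatrix _

variable {a b : Type*} [Fintype a] [Fintype b]

theorem trace_traceB (M : Matrix (a × b) (a × b) ℂ) : (traceB M).trace = M.trace := by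
  simp only [Matrix.trace, traceB, diag_apply, of_apply, Fintype.sum_prod_type]

theorem trace_mul_kronecker_one [DecidableEq b] (M : Matrix (a × b) (a × b) ℂ)
    (X : Matrix a a ℂ) : (M * (X ⊗ₖ (1 : Matrix b b ℂ))).trace = (traceB M * X).trace := by
  simp only [Matrix.trace, diag_apply, mul_apply, Fintype.sum_prod_type, kroneckerMap_apply,
    one_apply, mul_ite, mul_one, mul_zero, Finset.sum_ite_eq', Finset.mem_univ, if_true, traceB,
    of_apply, Finset.sum_mul]
  exact Finset.sum_congr rfl fun i _ => Finset.sum_comm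

theorem trace_mul_one_kronecker [DecidableEq a] (M : Matrix (a × b) (a × b) ℂ)
    (Y : Matrix b b ℂ) : (M * ((1 : Matrix a a ℂ) ⊗ₖ Y)).trace = (traceA M * Y).trace := by
  simp only [Matrix.trace, diag_apply, mul_apply, Fintype.sum_prod_type_right, kroneckerMap_apply,
    one_apply, mul_ite, ite_mul, one_mul, mul_zero, zero_mul, Finset.sum_ite_eq', Finset.mem_univ,
    if_true, traceA, of_apply, Finset.sum_mul]
  exact Finset.sum_congr rfl fun k _ => Finset.sum_comm

theorem traceA_kronecker_conj [DecidableEq a] {U : Matrix a a ℂ} (hU : Uᴴ * U = 1)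
    (V : Matrix b b ℂ) (M : Matrix (a × b) (a × b) ℂ) :
    traceA ((U ⊗ₖ V) * M * (U ⊗ₖ V)ᴴ) = V * traceA M * Vᴴ := by
  refine Matrix.ext_iff_trace_mul_right.2 fun Y => ?_
  calc (traceA ((U ⊗ₖ V) * M * (U ⊗ₖ V)ᴴ) * Y).trace
      = (M * ((U ⊗ₖ V)ᴴ * (1 ⊗ₖ Y) * (U ⊗ₖ V))).trace := by
        rw [← trace_mul_one_kronecker, mul_assoc, mul_assoc, trace_mul_comm]
        simp only [mul_assoc]
    _ = (traceA M * (Vᴴ * Y * V)).trace := by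
        rw [conjTranspose_kronecker, ← mul_kronecker_mul, ← mul_kronecker_mul, mul_one, hU,
          trace_mul_one_kronecker]
    _ = (V * traceA M * Vᴴ * Y).trace := by
        rw [trace_mul_cycle']
        simp only [mul_assoc]

theorem traceB_kronecker_conj [DecidableEq b] (U : Matrix a a ℂ) {V : Matrix b b ℂ}
    (hV : Vᴴ * V = 1) (M : Matrix (a × b) (a × b) ℂ) :
    traceB ((U ⊗ₖ V) * M * (U ⊗ₖ V)ᴴ) = U * traceB M * Uᴴ := by
  refine Matrix.ext_iff_trace_mul_right.2 fun X => ?_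
  calc (traceB ((U ⊗ₖ V) * M * (U ⊗ₖ V)ᴴ) * X).trace
      = (M * ((U ⊗ₖ V)ᴴ * (X ⊗ₖ 1) * (U ⊗ₖ V))).trace := by
        rw [← trace_mul_kronecker_one, mul_assoc, mul_assoc, trace_mul_comm]
        simp only [mul_assoc]
    _ = (traceB M * (Uᴴ * X * U)).trace := by
        rw [conjTranspose_kronecker, ← mul_kronecker_mul, ← mul_kronecker_mul, mul_one, hV,
          trace_mul_kronecker_one]
    _ = (U * traceB M * Uᴴ * X).trace := by
        rw [trace_mul_cycle']
        simp only [mul_assoc]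

theorem trace_sqrt_kronecker_one_le [DecidableEq a] [DecidableEq b]
    {ρ : Matrix (a × b) (a × b) ℂ} (hρ : ρ.PosSemidef) (K : Matrix a a ℂ) :
    ((K ⊗ₖ (1 : Matrix b b ℂ))ᴴ * CFC.sqrt ρ * (K ⊗ₖ 1) * CFC.sqrt ρ).trace ≤
      (Kᴴ * CFC.sqrt (traceB ρ) * K * CFC.sqrt (traceB ρ)).trace := by
  let Ψ : Matrix a a ℂ →ₗ[ℂ] Matrix (a × b) (a × b) ℂ := kroneckerBilinear.flip 1
  have hΨ : ∀ X, Ψ X = X ⊗ₖ 1 := fun _ => rfl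
  have hσ : (traceB ρ).PosSemidef := posSemidef_traceB hρ
  refine trace_conjTranspose_mul_sqrt_mul_mul_sqrt_le Ψ hρ hρ hσ hσ (fun X => le_of_eq ?_)
    (fun X => le_of_eq ?_) K
  · rw [hΨ, conjTranspose_kronecker, conjTranspose_one, mul_assoc, trace_mul_comm, mul_assoc,
      ← mul_kronecker_mul, mul_one, trace_mul_kronecker_one, ← mul_assoc, trace_mul_cycle]
  · rw [hΨ, conjTranspose_kronecker, conjTranspose_one, ← mul_kronecker_mul, mul_one,
      trace_mul_comm, trace_mul_kronecker_one, trace_mul_comm]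

end PartialTrace

section Channel

variable {a b c : Type*} {Φ : Matrix b b ℂ →ₗ[ℂ] Matrix c c ℂ}

/-- `idTensor` bundled as a linear map, so that `id ⊗ Φ` can itself be treated as a channel. -/
def idTensorLinearMap (a : Type*) (Φ : Matrix b b ℂ →ₗ[ℂ] Matrix c c ℂ) :
    Matrix (a × b) (a × b) ℂ →ₗ[ℂ] Matrix (a × c) (a × c) ℂ where
  toFun := idTensor Φ
  map_add' M N := by
    ext p q
    exact congrFun₂ (map_add Φ (of fun k l => M (p.1, k) (q.1, l))
      (of fun k l => N (p.1, k) (q.1, l))) p.2 q.2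
  map_smul' r M := by
    ext p q
    exact congrFun₂ (map_smul Φ r (of fun k l => M (p.1, k) (q.1, l))) p.2 q.2

theorem idTensorLinearMap_apply (M : Matrix (a × b) (a × b) ℂ) :
    idTensorLinearMap a Φ M = idTensor Φ M :=
  rfl

variable [Fintype b] [Fintype c]

theorem IsChannel.posSemidef_idTensor [Finite a] (hΦ : IsChannel Φ)
    {M : Matrix (a × b) (a × b) ℂ} (hM : M.PosSemidef) : (idTensor Φ M).PosSemidef := by
  let e := Finite.equivFin a
  have h := (hΦ.1 _ _ (hM.submatrix (Prod.map e.symm id))).submatrix (Prod.map e id)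
  simpa only [idTensor, submatrix, of_apply, Prod.map_fst, Prod.map_snd, Prod.map_apply, id_eq,
    Equiv.symm_apply_apply] using h

theorem IsChannel.posSemidef_fromBlocks_map (hΦ : IsChannel Φ) {A B C D : Matrix b b ℂ}
    (h : (fromBlocks A B C D).PosSemidef) :
    (fromBlocks (Φ A) (Φ B) (Φ C) (Φ D)).PosSemidef := by
  let f : Bool × b → b ⊕ b := fun p => bif p.1 then Sum.inr p.2 else Sum.inl p.2
  let g : c ⊕ c → Bool × c := Sum.elim (Prod.mk false) (Prod.mk true)
  have hfg : fromBlocks (Φ A) (Φ B) (Φ C) (Φ D) =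
      (idTensor Φ ((fromBlocks A B C D).submatrix f f)).submatrix g g := by
    ext (i | i) (j | j) <;> rfl
  rw [hfg]
  exact (hΦ.posSemidef_idTensor (h.submatrix f)).submatrix g

theorem IsChannel.posSemidef_map (hΦ : IsChannel Φ) {R : Matrix b b ℂ} (hR : R.PosSemidef) :
    (Φ R).PosSemidef :=
  (hΦ.posSemidef_fromBlocks_map (posSemidef_fromBlocks_zero_zero hR hR)).submatrix Sum.inl

theorem IsChannel.map_conjTranspose (hΦ : IsChannel Φ) (X : Matrix b b ℂ) :
    Φ Xᴴ = (Φ X)ᴴ := by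
  classical
  have h : (fromBlocks (X * Xᴴ) X Xᴴ 1).PosSemidef := by
    simpa [conjTranspose_fromRows_eq_fromCols_conjTranspose, fromRows_mul_fromCols] using
      posSemidef_self_mul_conjTranspose (fromRows X (1 : Matrix b b ℂ))
  exact ((isHermitian_fromBlocks_iff.1 (hΦ.posSemidef_fromBlocks_map h).1).2.1).symm

/-- The map on observables dual to `Φ` with respect to the trace pairing (the Heisenberg
picture of `Φ`). -/
def dualMap [DecidableEq b] (Φ : Matrix b b ℂ →ₗ[ℂ] Matrix c c ℂ) :
    Matrix c c ℂ →ₗ[ℂ] Matrix b b ℂ where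
  toFun Y := of fun i j => (Φ (single j i 1) * Y).trace
  map_add' Y Z := by
    ext i j
    simp only [of_apply, Matrix.add_apply, Matrix.mul_add, trace_add]
  map_smul' r Y := by
    ext i j
    simp only [of_apply, Matrix.smul_apply, Matrix.mul_smul, trace_smul, RingHom.id_apply]

theorem trace_map_mul [DecidableEq b] (Φ : Matrix b b ℂ →ₗ[ℂ] Matrix c c ℂ) (X : Matrix b b ℂ)
    (Y : Matrix c c ℂ) : (Φ X * Y).trace = (X * dualMap Φ Y).trace := by
  induction X using Matrix.induction_on' with
  | h_zero => simp only [map_zero, Matrix.zero_mul, trace_zero]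
  | h_add X X' hX hX' => simp only [map_add, Matrix.add_mul, trace_add, hX, hX']
  | h_std_basis i j x =>
    have hx : single i j x = x • single i j 1 := by rw [smul_single, smul_eq_mul, mul_one]
    rw [trace_single_mul, hx, map_smul, Matrix.smul_mul, trace_smul]
    rfl

theorem IsChannel.dualMap_conjTranspose [DecidableEq b] (hΦ : IsChannel Φ) (Y : Matrix c c ℂ) :
    dualMap Φ Yᴴ = (dualMap Φ Y)ᴴ := by
  refine Matrix.ext_iff_trace_mul_left.2 fun X => ?_
  calc (X * dualMap Φ Yᴴ).trace = (Φ X * Yᴴ).trace := (trace_map_mul Φ X Yᴴ).symm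
    _ = star (Φ Xᴴ * Y).trace := by
        rw [← trace_conjTranspose, conjTranspose_mul, hΦ.map_conjTranspose,
          conjTranspose_conjTranspose, trace_mul_comm]
    _ = (X * (dualMap Φ Y)ᴴ).trace := by
        rw [trace_map_mul, ← trace_conjTranspose, conjTranspose_mul, conjTranspose_conjTranspose,
          trace_mul_comm]

/-- The Kadison–Schwarz inequality `Φ†(X)† Φ†(X) ≤ Φ†(X† X)` for the dual map `Φ†`, applied to
`X†` and paired with a positive matrix `R`. -/
theorem IsChannel.trace_conjTranspose_dualMap_mul_mul_le [DecidableEq b] (hΦ : IsChannel Φ)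
    {R : Matrix b b ℂ} (hR : R.PosSemidef) (X : Matrix c c ℂ) :
    ((dualMap Φ X)ᴴ * R * dualMap Φ X).trace ≤ (Xᴴ * Φ R * X).trace := by
  classical
  set Z := dualMap Φ X with hZ
  have hblock : (fromBlocks (Zᴴ * R * Z) (Zᴴ * R) (R * Z) R).PosSemidef := by
    simpa [conjTranspose_fromCols_eq_fromRows_conjTranspose, fromRows_mul, fromRows_mul_fromCols]
      using hR.conjTranspose_mul_mul_same (fromCols Z (1 : Matrix b b ℂ))
  have h := ((hΦ.posSemidef_fromBlocks_map hblock).conjTranspose_mul_mul_same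
    (fromRows (1 : Matrix c c ℂ) (-X))).trace_nonneg
  have h₁ : (Xᴴ * Φ (R * Z)).trace = (Zᴴ * R * Z).trace := by
    rw [trace_mul_comm, trace_map_mul, hΦ.dualMap_conjTranspose, ← hZ, trace_mul_comm, mul_assoc]
  have h₂ : (Φ (Zᴴ * R) * X).trace = (Zᴴ * R * Z).trace := trace_map_mul Φ _ X
  have hexpand : ((fromRows (1 : Matrix c c ℂ) (-X))ᴴ *
      fromBlocks (Φ (Zᴴ * R * Z)) (Φ (Zᴴ * R)) (Φ (R * Z)) (Φ R) *
        fromRows (1 : Matrix c c ℂ) (-X)).trace =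
      (Xᴴ * Φ R * X).trace - (Zᴴ * R * Z).trace := by
    simp only [conjTranspose_fromRows_eq_fromCols_conjTranspose, conjTranspose_one,
      conjTranspose_neg, Matrix.mul_assoc, fromBlocks_mul_fromRows, mul_one, mul_neg,
      fromCols_mul_fromRows, one_mul, neg_mul, Matrix.mul_add, neg_add_rev, neg_neg, trace_add,
      hΦ.2, trace_neg]
    rw [h₂, h₁, Matrix.mul_assoc Zᴴ]
    ring
  exact sub_nonneg.1 (hexpand ▸ h)

theorem IsChannel.trace_conjTranspose_dualMap_mul_self_mul_le [DecidableEq b] (hΦ : IsChannel Φ)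
    {R : Matrix b b ℂ} (hR : R.PosSemidef) (X : Matrix c c ℂ) :
    ((dualMap Φ X)ᴴ * dualMap Φ X * R).trace ≤ (Xᴴ * X * Φ R).trace := by
  have h := hΦ.trace_conjTranspose_dualMap_mul_mul_le hR Xᴴ
  rwa [hΦ.dualMap_conjTranspose, conjTranspose_conjTranspose, conjTranspose_conjTranspose,
    trace_mul_cycle, trace_mul_cycle X] at h

theorem IsChannel.trace_sqrt_dualMap_le [DecidableEq b] [DecidableEq c] (hΦ : IsChannel Φ)
    {R : Matrix b b ℂ} (hR : R.PosSemidef) (X : Matrix c c ℂ) :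
    ((dualMap Φ X)ᴴ * CFC.sqrt R * dualMap Φ X * CFC.sqrt R).trace ≤
      (Xᴴ * CFC.sqrt (Φ R) * X * CFC.sqrt (Φ R)).trace :=
  trace_conjTranspose_mul_sqrt_mul_mul_sqrt_le (dualMap Φ) hR hR (hΦ.posSemidef_map hR)
    (hΦ.posSemidef_map hR)
    (hΦ.trace_conjTranspose_dualMap_mul_mul_le hR)
    (hΦ.trace_conjTranspose_dualMap_mul_self_mul_le hR) X

theorem IsChannel.traceB_idTensor (hΦ : IsChannel Φ) (M : Matrix (a × b) (a × b) ℂ) :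
    traceB (idTensor Φ M) = traceB M := by
  ext i j
  exact hΦ.2 (of fun k l => M (i, k) (j, l))

variable [Fintype a]

theorem IsChannel.isChannel_idTensorLinearMap (hΦ : IsChannel Φ) :
    IsChannel (idTensorLinearMap a Φ) := by
  refine ⟨fun n M hM => ?_, fun M => ?_⟩
  · exact (hΦ.posSemidef_idTensor (hM.submatrix (Equiv.prodAssoc (Fin n) a b))).submatrix
      (Equiv.prodAssoc (Fin n) a c).symm
  · rw [idTensorLinearMap_apply, ← trace_traceB, hΦ.traceB_idTensor, trace_traceB]

theorem IsChannel.isState_idTensor (hΦ : IsChannel Φ) {ρ : Matrix (a × b) (a × b) ℂ}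
    (hρ : IsState ρ) : IsState (idTensor Φ ρ) :=
  ⟨hΦ.posSemidef_idTensor hρ.1, (hΦ.isChannel_idTensorLinearMap.2 ρ).trans hρ.2⟩

variable [DecidableEq a] [DecidableEq b] [DecidableEq c]

theorem IsChannel.dualMap_idTensorLinearMap_kronecker_one (hΦ : IsChannel Φ) (K : Matrix a a ℂ) :
    dualMap (idTensorLinearMap a Φ) (K ⊗ₖ (1 : Matrix c c ℂ)) =
      K ⊗ₖ (1 : Matrix b b ℂ) := by
  refine Matrix.ext_iff_trace_mul_left.2 fun M => ?_
  calc (M * dualMap (idTensorLinearMap a Φ) (K ⊗ₖ (1 : Matrix c c ℂ))).trace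
      = (idTensor Φ M * (K ⊗ₖ (1 : Matrix c c ℂ))).trace := (trace_map_mul _ M _).symm
    _ = (M * (K ⊗ₖ (1 : Matrix b b ℂ))).trace := by
        rw [trace_mul_kronecker_one, hΦ.traceB_idTensor, trace_mul_kronecker_one]

theorem IsChannel.trace_sqrt_kronecker_one_le_idTensor (hΦ : IsChannel Φ)
    {ρ : Matrix (a × b) (a × b) ℂ} (hρ : ρ.PosSemidef) (K : Matrix a a ℂ) :
    ((K ⊗ₖ (1 : Matrix b b ℂ))ᴴ * CFC.sqrt ρ * (K ⊗ₖ 1) * CFC.sqrt ρ).trace ≤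
      ((K ⊗ₖ (1 : Matrix c c ℂ))ᴴ * CFC.sqrt (idTensor Φ ρ) * (K ⊗ₖ 1) *
        CFC.sqrt (idTensor Φ ρ)).trace := by
  have h := hΦ.isChannel_idTensorLinearMap.trace_sqrt_dualMap_le hρ (K ⊗ₖ (1 : Matrix c c ℂ))
  rwa [hΦ.dualMap_idTensorLinearMap_kronecker_one, idTensorLinearMap_apply] at h

end Channel

section BasisCorrelation

theorem coe_skewInfo_of_mul_self {n : Type*} [Fintype n] [DecidableEq n] {ρ K : Matrix n n ℂ}
    (hρ : ρ.PosSemidef) (hK : K.IsHermitian) (hKK : K * K = K) :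
    (skewInfo ρ K : ℂ) = (ρ * K).trace - (Kᴴ * CFC.sqrt ρ * K * CFC.sqrt ρ).trace := by
  have hSS : CFC.sqrt ρ * CFC.sqrt ρ = ρ := CFC.sqrt_mul_sqrt_self ρ hρ.nonneg
  rw [coe_skewInfo _ _ hK, hK.eq]
  set S := CFC.sqrt ρ
  have hsq : (S * K - K * S) ^ 2 =
      S * (K * S * K) + K * S * K * S - S * (K * K) * S - K * (S * S) * K := by noncomm_ring
  rw [hsq, hKK, hSS]
  simp only [trace_add, trace_sub]
  rw [trace_mul_comm S (K * S * K), trace_mul_comm (S * K) S, ← mul_assoc S, hSS,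
    trace_mul_cycle K ρ K, hKK, trace_mul_comm K ρ]
  ring

theorem coe_sum_skewInfo {ι n : Type*} [Fintype ι] [Fintype n] [DecidableEq n]
    {ρ : Matrix n n ℂ} (hρ : ρ.PosSemidef) {K : ι → Matrix n n ℂ}
    (hK : ∀ i, (K i).IsHermitian) (hKK : ∀ i, K i * K i = K i) (hsum : ∑ i, K i = 1) :
    ((∑ i, skewInfo ρ (K i) : ℝ) : ℂ) =
      ρ.trace - ∑ i, ((K i)ᴴ * CFC.sqrt ρ * K i * CFC.sqrt ρ).trace := by
  rw [Complex.ofReal_sum]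
  simp only [fun i => coe_skewInfo_of_mul_self hρ (hK i) (hKK i), Finset.sum_sub_distrib]
  rw [← trace_sum, ← Matrix.mul_sum, hsum, mul_one]

theorem sum_ketbra {d : ℕ} (P : ONB d) : ∑ m, ketbra (P m) = 1 := by
  ext i j
  have h := P.sum_inner_mul_inner (EuclideanSpace.single i (1 : ℂ)) (EuclideanSpace.single j 1)
  simp only [EuclideanSpace.inner_single_left, EuclideanSpace.inner_single_right, map_one,
    one_mul] at h
  rw [Matrix.sum_apply]
  simpa [ketbra, one_apply, Pi.single_apply, eq_comm] using h

theorem trace_ketbra {d : ℕ} (v : EuclideanSpace ℂ (Fin d)) (hv : ‖v‖ = 1) :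
    (ketbra v).trace = 1 := by
  calc (ketbra v).trace = inner ℂ v v := by rw [PiLp.inner_apply]; rfl
    _ = 1 := by rw [inner_self_eq_norm_sq_to_K, hv]; simp

theorem ketbra_mul_self {d : ℕ} (v : EuclideanSpace ℂ (Fin d)) (hv : ‖v‖ = 1) :
    ketbra v * ketbra v = ketbra v := by
  have h : ∑ k, v k * star (v k) = 1 := trace_ketbra v hv
  ext i j
  simp only [mul_apply, ketbra, of_apply]
  calc ∑ k, v i * star (v k) * (v k * star (v j))
      = v i * star (v j) * ∑ k, v k * star (v k) := by
        rw [Finset.mul_sum]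
        exact Finset.sum_congr rfl fun k _ => by ring
    _ = v i * star (v j) := by rw [h, mul_one]

variable {dA dB : ℕ}

theorem coe_correlation {ρ : Matrix (Fin dA × Fin dB) (Fin dA × Fin dB) ℂ} (hρ : IsState ρ)
    (P : ONB dA) :
    (correlation ρ P : ℂ) =
      ∑ i, ((ketbra (P i))ᴴ * CFC.sqrt (traceB ρ) * ketbra (P i) * CFC.sqrt (traceB ρ)).trace -
      ∑ i, ((ketbra (P i) ⊗ₖ (1 : Matrix (Fin dB) (Fin dB) ℂ))ᴴ * CFC.sqrt ρ *
        (ketbra (P i) ⊗ₖ 1) * CFC.sqrt ρ).trace := by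
  have hidem : ∀ i, ketbra (P i) * ketbra (P i) = ketbra (P i) := fun i =>
    ketbra_mul_self _ (P.orthonormal.1 i)
  have hsum : ∑ i, ketbra (P i) ⊗ₖ (1 : Matrix (Fin dB) (Fin dB) ℂ) = 1 := by
    have hlin := map_sum (kroneckerBilinear.flip 1 :
      Matrix (Fin dA) (Fin dA) ℂ →ₗ[ℂ] Matrix (Fin dA × Fin dB) (Fin dA × Fin dB) ℂ)
      (fun i => ketbra (P i)) Finset.univ
    rw [sum_ketbra] at hlin
    exact hlin.symm.trans one_kronecker_one
  rw [correlation_eq hρ, partialCoherence, coherence, Complex.ofReal_sub,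
    coe_sum_skewInfo hρ.1 (fun i => isHermitian_kronecker (ketbra_isHermitian _) isHermitian_one)
      (fun i => by rw [← mul_kronecker_mul, hidem, mul_one]) hsum,
    coe_sum_skewInfo hρ.traceB.1 (fun i => ketbra_isHermitian _) hidem (sum_ketbra P), hρ.2,
    hρ.traceB.2]
  ring

theorem correlation_nonneg {ρ : Matrix (Fin dA × Fin dB) (Fin dA × Fin dB) ℂ} (hρ : IsState ρ)
    (P : ONB dA) : 0 ≤ correlation ρ P := by
  rw [← Complex.zero_le_real, coe_correlation hρ, sub_nonneg]
  exact Finset.sum_le_sum fun i _ => trace_sqrt_kronecker_one_le hρ.1 _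

theorem IsChannel.correlation_idTensor_le {dB' : ℕ}
    {Φ : Matrix (Fin dB) (Fin dB) ℂ →ₗ[ℂ] Matrix (Fin dB') (Fin dB') ℂ} (hΦ : IsChannel Φ)
    {ρ : Matrix (Fin dA × Fin dB) (Fin dA × Fin dB) ℂ} (hρ : IsState ρ) (P : ONB dA) :
    correlation (idTensor Φ ρ) P ≤ correlation ρ P := by
  rw [← Complex.real_le_real, coe_correlation hρ, coe_correlation (hΦ.isState_idTensor hρ),
    hΦ.traceB_idTensor]
  exact sub_le_sub_left
    (Finset.sum_le_sum fun i _ => hΦ.trace_sqrt_kronecker_one_le_idTensor hρ.1 _) _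

theorem Qmub_nonneg (B : Fin (dA + 1) → ONB dA)
    {ρ : Matrix (Fin dA × Fin dB) (Fin dA × Fin dB) ℂ} (hρ : IsState ρ) : 0 ≤ Qmub B ρ :=
  mul_nonneg (by positivity) (Finset.sum_nonneg fun t _ => correlation_nonneg hρ (B t))

theorem Qmub_eq_zero_of_eq_kronecker (B : Fin (dA + 1) → ONB dA)
    {ρ : Matrix (Fin dA × Fin dB) (Fin dA × Fin dB) ℂ} (h : ρ = traceB ρ ⊗ₖ traceA ρ) :
    Qmub B ρ = 0 := by
  simp only [Qmub, correlation, ← h, sub_self, Finset.sum_const_zero, mul_zero]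

theorem IsChannel.Qmub_idTensor_le {dB' : ℕ}
    {Φ : Matrix (Fin dB) (Fin dB) ℂ →ₗ[ℂ] Matrix (Fin dB') (Fin dB') ℂ} (hΦ : IsChannel Φ)
    (B : Fin (dA + 1) → ONB dA) {ρ : Matrix (Fin dA × Fin dB) (Fin dA × Fin dB) ℂ}
    (hρ : IsState ρ) : Qmub B (idTensor Φ ρ) ≤ Qmub B ρ :=
  mul_le_mul_of_nonneg_left
    (Finset.sum_le_sum fun t _ => hΦ.correlation_idTensor_le hρ (B t)) (by positivity)

end BasisCorrelation

section TwoDesign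

/-- The operator exchanging the two factors of `ℂᵃ ⊗ ℂᵃ`; `1 + swapMatrix a` is twice the
projection onto the symmetric subspace, which is what the two-fold tensors of a projective
2-design average to. -/
def swapMatrix (a : Type*) [DecidableEq a] : Matrix (a × a) (a × a) ℂ :=
  Equiv.Perm.permMatrix ℂ (Equiv.prodComm a a)

section SwapMatrix

variable {a : Type*} [DecidableEq a]

theorem swapMatrix_apply (i j k l : a) :
    swapMatrix a (i, k) (j, l) = (1 : Matrix a a ℂ) i l * (1 : Matrix a a ℂ) k j := by
  simp only [swapMatrix, Equiv.Perm.permMatrix, PEquiv.toMatrix_toPEquiv_apply, one_apply,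
    Equiv.prodComm_apply, Prod.swap_prod_mk, Pi.single_apply, Prod.mk.injEq]
  split_ifs <;> simp_all

theorem isHermitian_swapMatrix : (swapMatrix a).IsHermitian :=
  conjTranspose_permMatrix _

variable [Fintype a]

theorem swapMatrix_mul_self : swapMatrix a * swapMatrix a = 1 := by
  rw [swapMatrix, ← permMatrix_mul]
  exact permMatrix_one

theorem trace_kronecker_mul_swapMatrix (X Y : Matrix a a ℂ) :
    ((X ⊗ₖ Y) * swapMatrix a).trace = (X * Y).trace := by
  simp only [swapMatrix, PEquiv.mul_toMatrix_toPEquiv, Matrix.trace, diag_apply, mul_apply,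
    Fintype.sum_prod_type]
  rfl

theorem trace_swapMatrix : (swapMatrix a).trace = Fintype.card a := by
  simpa using trace_kronecker_mul_swapMatrix (1 : Matrix a a ℂ) 1

theorem trace_one_add_swapMatrix_mul_self :
    ((1 + swapMatrix a) * (1 + swapMatrix a)).trace =
      2 * ((Fintype.card a + 1) * Fintype.card a) := by
  rw [add_mul, mul_add, mul_add, swapMatrix_mul_self]
  simp only [one_mul, mul_one, trace_add, trace_swapMatrix, trace_one, Fintype.card_prod]
  push_cast
  ring

end SwapMatrix

theorem trace_ketbra_mul_ketbra {d : ℕ} (v w : EuclideanSpace ℂ (Fin d)) :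
    (ketbra v * ketbra w).trace = ((‖inner ℂ v w‖ ^ 2 : ℝ) : ℂ) := by
  have hinner : inner ℂ v w = ∑ i, w i * star (v i) := rfl
  push_cast
  rw [← Complex.mul_conj', hinner, map_sum, Finset.sum_mul_sum]
  simp only [Matrix.trace, diag_apply, mul_apply, ketbra, of_apply]
  rw [Finset.sum_comm]
  refine Finset.sum_congr rfl fun i _ => Finset.sum_congr rfl fun j _ => ?_
  simp only [map_mul, RCLike.star_def, Complex.conj_conj]
  ring

theorem sum_trace_ketbra_mul_ketbra_sq_self {d : ℕ} (P : ONB d) (m : Fin d) :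
    ∑ k, (ketbra (P m) * ketbra (P k)).trace ^ 2 = 1 := by
  simp only [trace_ketbra_mul_ketbra, orthonormal_iff_ite.1 P.orthonormal]
  rw [Finset.sum_eq_single_of_mem m (Finset.mem_univ m)] <;> simp +contextual [eq_comm]

theorem MutuallyUnbiased.sum_trace_ketbra_mul_ketbra_sq {d : ℕ} {P₁ P₂ : ONB d}
    (h : MutuallyUnbiased P₁ P₂) (m : Fin d) :
    ∑ k, (ketbra (P₁ m) * ketbra (P₂ k)).trace ^ 2 = 1 / d := by
  have hd : (d : ℂ) ≠ 0 := by exact_mod_cast m.pos.ne'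
  simp only [trace_ketbra_mul_ketbra, h m, div_pow, Real.sq_sqrt (Nat.cast_nonneg d),
    Finset.sum_const, Finset.card_univ, Fintype.card_fin, nsmul_eq_mul]
  push_cast
  field_simp

namespace IsCompleteMUB

variable {d : ℕ} {B : Fin (d + 1) → ONB d}

theorem sum_trace_ketbra_mul_ketbra_sq (hB : IsCompleteMUB B) (t : Fin (d + 1)) (m : Fin d) :
    ∑ q : Fin (d + 1) × Fin d, (ketbra (B t m) * ketbra (B q.1 q.2)).trace ^ 2 = 2 := by
  have hd : (d : ℂ) ≠ 0 := by exact_mod_cast m.pos.ne'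
  have hoff : ∀ s ∈ ({t} : Finset (Fin (d + 1)))ᶜ,
      ∑ k, (ketbra (B t m) * ketbra (B s k)).trace ^ 2 = 1 / (d : ℂ) := fun s hs =>
    (hB t s (by simpa [eq_comm] using hs)).sum_trace_ketbra_mul_ketbra_sq m
  rw [Fintype.sum_prod_type, Fintype.sum_eq_add_sum_compl t, sum_trace_ketbra_mul_ketbra_sq_self,
    Finset.sum_congr rfl hoff, Finset.sum_const, Finset.card_compl, Finset.card_singleton,
    Fintype.card_fin, add_tsub_cancel_right, nsmul_eq_mul, mul_one_div_cancel hd,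
    one_add_one_eq_two]

/-- A complete set of mutually unbiased bases is a projective 2-design. All Frobenius inner products
of the two sides with each other and with themselves agree, so their difference vanishes. -/
theorem sum_ketbra_kronecker_ketbra (hB : IsCompleteMUB B) :
    ∑ q : Fin (d + 1) × Fin d, ketbra (B q.1 q.2) ⊗ₖ ketbra (B q.1 q.2) =
      1 + swapMatrix (Fin d) := by
  have hunit : ∀ q : Fin (d + 1) × Fin d, ‖B q.1 q.2‖ = 1 := fun q => (B q.1).orthonormal.1 q.2
  have hcard : ∑ _q : Fin (d + 1) × Fin d, (2 : ℂ) = 2 * ((d + 1) * d) := by simp [mul_comm]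
  set G := ∑ q : Fin (d + 1) × Fin d, ketbra (B q.1 q.2) ⊗ₖ ketbra (B q.1 q.2) with hG
  set J : Matrix (Fin d × Fin d) (Fin d × Fin d) ℂ := 1 + swapMatrix (Fin d) with hJ
  have hG_herm : G.IsHermitian := by
    simp only [IsHermitian, hG, conjTranspose_sum, conjTranspose_kronecker,
      (ketbra_isHermitian _).eq]
  have hJ_herm : J.IsHermitian := isHermitian_one.add isHermitian_swapMatrix
  have hGG : (G * G).trace = 2 * ((d + 1) * d) := by
    simp only [hG, Matrix.sum_mul, Matrix.mul_sum, trace_sum, ← mul_kronecker_mul,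
      trace_kronecker, ← hcard]
    rw [Finset.sum_comm]
    refine Finset.sum_congr rfl fun q _ => ?_
    simpa only [pow_two] using hB.sum_trace_ketbra_mul_ketbra_sq q.1 q.2
  have hGJ : (G * J).trace = 2 * ((d + 1) * d) := by
    simp only [hG, hJ, Matrix.sum_mul, Matrix.mul_add, Matrix.mul_one, trace_sum, trace_add,
      trace_kronecker, trace_kronecker_mul_swapMatrix, ketbra_mul_self _ (hunit _),
      trace_ketbra _ (hunit _), one_mul, ← hcard, ← Finset.sum_add_distrib,
      one_add_one_eq_two]
  have hJJ : (J * J).trace = 2 * ((d + 1) * d) := by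
    rw [hJ, trace_one_add_swapMatrix_mul_self, Fintype.card_fin]
  have hdist : ((G - J)ᴴ * (G - J)).trace = 0 := by
    rw [(hG_herm.sub hJ_herm).eq, sub_mul, mul_sub, mul_sub, trace_sub, trace_sub, trace_sub,
      trace_mul_comm J G, hGG, hGJ, hJJ, sub_self]
  exact sub_eq_zero.1 (trace_conjTranspose_mul_self_eq_zero_iff.1 hdist)

end IsCompleteMUB

section Averages

variable {ι a : Type*} [Fintype ι] [Fintype a] [DecidableEq a] {K : ι → Matrix a a ℂ}

theorem sum_trace_mul_mul_mul (hK : ∑ q, K q ⊗ₖ K q = 1 + swapMatrix a) (M : Matrix a a ℂ) :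
    ∑ q, (K q * M * K q * M).trace = (M * M).trace + M.trace ^ 2 := by
  calc ∑ q, (K q * M * K q * M).trace
      = (((∑ q, K q ⊗ₖ K q) * (M ⊗ₖ M)) * swapMatrix a).trace := by
        simp only [Matrix.sum_mul, trace_sum, ← mul_kronecker_mul,
          trace_kronecker_mul_swapMatrix, mul_assoc]
    _ = (M * M).trace + M.trace ^ 2 := by
        rw [hK, add_mul, one_mul, add_mul, trace_add, trace_kronecker_mul_swapMatrix,
          trace_mul_cycle, swapMatrix_mul_self, one_mul, trace_kronecker, pow_two]

theorem sum_kronecker_one_mul_mul_kronecker_one {b : Type*} [Fintype b] [DecidableEq b]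
    (hK : ∑ q, K q ⊗ₖ K q = 1 + swapMatrix a) (S : Matrix (a × b) (a × b) ℂ) :
    ∑ q, (K q ⊗ₖ (1 : Matrix b b ℂ)) * S * (K q ⊗ₖ 1) = S + 1 ⊗ₖ traceA S := by
  have hentry : ∀ i k j l, ∑ q, K q i j * K q k l =
      (1 : Matrix a a ℂ) i j * (1 : Matrix a a ℂ) k l +
        (1 : Matrix a a ℂ) i l * (1 : Matrix a a ℂ) k j := fun i k j l => by
    have h := congrFun (congrFun hK (i, k)) (j, l)
    rwa [Matrix.sum_apply, Matrix.add_apply, swapMatrix_apply, ← one_kronecker_one] at h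
  ext ⟨i, k⟩ ⟨j, l⟩
  calc (∑ q, (K q ⊗ₖ 1) * S * (K q ⊗ₖ 1) : Matrix (a × b) (a × b) ℂ) (i, k) (j, l)
      = ∑ y, ∑ x, (∑ q, K q i x * K q y j) * S (x, k) (y, l) := by
        simp only [Matrix.sum_apply, mul_apply, kroneckerMap_apply, Fintype.sum_prod_type,
          one_apply, mul_ite, mul_one, mul_zero, ite_mul, zero_mul, Finset.sum_ite_eq,
          Finset.sum_ite_eq', Finset.mem_univ, if_true, Finset.sum_mul]
        rw [Finset.sum_comm]
        refine Finset.sum_congr rfl fun y _ => ?_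
        rw [Finset.sum_comm]
        exact Finset.sum_congr rfl fun x _ => Finset.sum_congr rfl fun q _ => mul_right_comm _ _ _
    _ = (S + 1 ⊗ₖ traceA S : Matrix (a × b) (a × b) ℂ) (i, k) (j, l) := by
        simp only [hentry, add_mul, Finset.sum_add_distrib, Matrix.add_apply, kroneckerMap_apply,
          traceA, of_apply, Finset.mul_sum]
        simp [one_apply]

theorem sum_trace_kronecker_one_mul_mul_mul {b : Type*} [Fintype b] [DecidableEq b]
    (hK : ∑ q, K q ⊗ₖ K q = 1 + swapMatrix a) (S : Matrix (a × b) (a × b) ℂ) :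
    ∑ q, ((K q ⊗ₖ (1 : Matrix b b ℂ)) * S * (K q ⊗ₖ 1) * S).trace =
      (S * S).trace + (traceA S ^ 2).trace := by
  rw [← trace_sum, ← Matrix.sum_mul, sum_kronecker_one_mul_mul_kronecker_one hK, add_mul,
    trace_add, trace_mul_comm (1 ⊗ₖ traceA S), trace_mul_one_kronecker, pow_two]

end Averages

end TwoDesign

section ClosedForm

variable {dA dB : ℕ} {B : Fin (dA + 1) → ONB dA}

theorem coe_Qmub (hB : IsCompleteMUB B) {ρ : Matrix (Fin dA × Fin dB) (Fin dA × Fin dB) ℂ}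
    (hρ : IsState ρ) :
    (Qmub B ρ : ℂ) =
      ((CFC.sqrt (traceB ρ)).trace ^ 2 - (traceA (CFC.sqrt ρ) ^ 2).trace) / ((dA : ℂ) + 1) := by
  have hmarg := sum_trace_mul_mul_mul hB.sum_ketbra_kronecker_ketbra (CFC.sqrt (traceB ρ))
  have hjoint :=
    sum_trace_kronecker_one_mul_mul_mul hB.sum_ketbra_kronecker_ketbra (CFC.sqrt ρ)
  rw [CFC.sqrt_mul_sqrt_self _ hρ.traceB.1.nonneg, hρ.traceB.2, Fintype.sum_prod_type] at hmarg
  rw [CFC.sqrt_mul_sqrt_self _ hρ.1.nonneg, hρ.2, Fintype.sum_prod_type] at hjoint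
  rw [Qmub, Complex.ofReal_mul, Complex.ofReal_sum]
  simp only [coe_correlation hρ, (ketbra_isHermitian _).eq,
    (isHermitian_kronecker (ketbra_isHermitian _) isHermitian_one).eq, Finset.sum_sub_distrib,
    hmarg, hjoint, add_sub_add_left_eq_sub]
  push_cast
  ring

end ClosedForm

section UnitaryInvariance

variable {m n : Type*} [Fintype m] [DecidableEq m] [Fintype n]

theorem trace_conj {V : Matrix n m ℂ} (hV : Vᴴ * V = 1) (M : Matrix m m ℂ) :
    (V * M * Vᴴ).trace = M.trace := by
  rw [trace_mul_cycle, hV, one_mul]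

theorem conj_mul_conj {V : Matrix n m ℂ} (hV : Vᴴ * V = 1) (M N : Matrix m m ℂ) :
    V * M * Vᴴ * (V * N * Vᴴ) = V * (M * N) * Vᴴ := by
  calc V * M * Vᴴ * (V * N * Vᴴ) = V * M * (Vᴴ * V) * N * Vᴴ := by simp only [Matrix.mul_assoc]
    _ = V * (M * N) * Vᴴ := by rw [hV, Matrix.mul_one, Matrix.mul_assoc V]

theorem sqrt_conj [DecidableEq n] {ρ : Matrix m m ℂ} (hρ : ρ.PosSemidef) {V : Matrix n m ℂ}
    (hV : Vᴴ * V = 1) : CFC.sqrt (V * ρ * Vᴴ) = V * CFC.sqrt ρ * Vᴴ := by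
  rw [CFC.sqrt_eq_iff _ _ (hρ.mul_mul_conjTranspose_same V).nonneg
    ((posSemidef_sqrt ρ).mul_mul_conjTranspose_same V).nonneg, conj_mul_conj hV,
    CFC.sqrt_mul_sqrt_self ρ hρ.nonneg]

theorem IsState.conj {ρ : Matrix m m ℂ} (hρ : IsState ρ) {V : Matrix n m ℂ} (hV : Vᴴ * V = 1) :
    IsState (V * ρ * Vᴴ) :=
  ⟨hρ.1.mul_mul_conjTranspose_same V, (trace_conj hV ρ).trans hρ.2⟩

theorem Qmub_kronecker_conj {dA dB : ℕ} {B : Fin (dA + 1) → ONB dA} (hB : IsCompleteMUB B)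
    {ρ : Matrix (Fin dA × Fin dB) (Fin dA × Fin dB) ℂ} (hρ : IsState ρ)
    {U : Matrix (Fin dA) (Fin dA) ℂ} (hU : Uᴴ * U = 1)
    {V : Matrix (Fin dB) (Fin dB) ℂ} (hV : Vᴴ * V = 1) :
    Qmub B ((U ⊗ₖ V) * ρ * (U ⊗ₖ V)ᴴ) = Qmub B ρ := by
  have hUV : (U ⊗ₖ V)ᴴ * (U ⊗ₖ V) = 1 := by
    rw [conjTranspose_kronecker, ← mul_kronecker_mul, hU, hV, one_kronecker_one]
  rw [← Complex.ofReal_inj, coe_Qmub hB (hρ.conj hUV), coe_Qmub hB hρ, sqrt_conj hρ.1 hUV,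
    traceB_kronecker_conj U hV, traceA_kronecker_conj hU, sqrt_conj hρ.traceB.1 hU, trace_conj hU,
    pow_two (V * _ * _), conj_mul_conj hV, trace_conj hV, pow_two (traceA _)]

end UnitaryInvariance

end AvgCorrelation

theorem proposition1 (dA dB : ℕ) (B : Fin (dA + 1) → ONB dA) (hB : IsCompleteMUB B)
    (ρ : Matrix (Fin dA × Fin dB) (Fin dA × Fin dB) ℂ) (hρ : IsState ρ) :
    -- non-negativity, and vanishing on product states
    (0 ≤ Qmub B ρ ∧ (ρ = traceB ρ ⊗ₖ traceA ρ → Qmub B ρ = 0)) ∧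
    -- contractivity under channels on the second party
    (∀ (dB' : ℕ) (Φ : Matrix (Fin dB) (Fin dB) ℂ →ₗ[ℂ] Matrix (Fin dB') (Fin dB') ℂ),
      IsChannel Φ → Qmub B (idTensor Φ ρ) ≤ Qmub B ρ) ∧
    -- local unitary invariance
    (∀ UA ∈ Matrix.unitaryGroup (Fin dA) ℂ, ∀ UB ∈ Matrix.unitaryGroup (Fin dB) ℂ,
      Qmub B ((UA ⊗ₖ UB) * ρ * (UA ⊗ₖ UB)ᴴ) = Qmub B ρ) ∧
    -- closed form
    (Qmub B ρ : ℂ) =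
      ((CFC.sqrt (traceB ρ)).trace ^ 2 - (traceA (CFC.sqrt ρ) ^ 2).trace) / ((dA : ℂ) + 1) := by
  refine ⟨⟨Qmub_nonneg B hρ, Qmub_eq_zero_of_eq_kronecker B⟩, fun dB' Φ hΦ => ?_,
    fun UA hUA UB hUB => ?_, coe_Qmub hB hρ⟩
  · exact hΦ.Qmub_idTensor_le B hρ
  · exact Qmub_kronecker_conj hB hρ (mem_unitaryGroup_iff'.1 hUA) (mem_unitaryGroup_iff'.1 hUB)
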